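/- All graphs are finite and simple. The treedepth $\mathrm{td}(G)$ of a graph $G$ is the minimum integer $d$ for which there exists a rooted forest $F$ with vertex set $V(G)$ in which every root-to-leaf path has at most $d$ vertices, and such that every edge of $G$ joins a vertex to one of its ancestors or descendants in $F$. A graph is chordal if it contains no induced cycle of length at least $4$. A class $\mathcal{G}$ of graphs is fractionally $\mathrm{td}$-fragile at a rate $r$ (a non-decreasing function from $\mathbb{N}$ to the non-negative reals) if for every $G\in\mathcal{G}$ and every positive integer $a$ there exists a probability distribution on the subsets $Y\subseteq V(G)$ satisfying $\mathrm{td}(G-Y)\le r(a)$, such that each vertex of $G$ belongs to a set sampled from this distribution with probability at most $1/a$. Theorem. The class of planar chordal graphs is fractionally $\mathrm{td}$-fragile at rate $r(a)=8a^2\bigl(2+\lceil\log_2 a\rceil\bigr)$, where $r(0)=0$. -/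

import Mathlib

open scoped NNReal ENNReal

universe u

namespace Fragility

/-! ### Graph parameters and graph classes (all graphs are finite and simple) -/

/-- A graph parameter: a non-negative real number for every finite graph, invariant under
isomorphism. -/
structure GraphParameter where
  val : ∀ {V : Type u} [Finite V], SimpleGraph V → ℝ≥0
  val_eq_of_iso : ∀ {V W : Type u} [Finite V] [Finite W] (G : SimpleGraph V) (H : SimpleGraph W),
    (G ≃g H) → val G = val H

/-- A class of finite graphs. -/
abbrev GraphClass := ∀ (V : Type u) [Finite V], SimpleGraph V → Prop

/-! ### Fractional fragility -/

/-- The set of all `Y ⊆ V(G)` such that `f (G - Y) ≤ b`. -/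
def deletionSets (f : GraphParameter.{u}) {V : Type u} [Finite V] (G : SimpleGraph V) (b : ℝ) :
    Set (Set V) :=
  {Y | (f.val (G.induce Yᶜ) : ℝ) ≤ b}

/-- A probability distribution on the subsets of `V` is `ε`-thin if every vertex belongs to the
random set with probability at most `ε`. -/
def IsThin {V : Type u} (ε : ℝ) (μ : PMF (Set V)) : Prop :=
  ∀ v : V, μ.toOuterMeasure {Y | v ∈ Y} ≤ ENNReal.ofReal ε

/-- `G` is fractionally `f`-fragile at the (non-decreasing) rate `r`. -/
def IsFractionallyFragile (f : GraphParameter.{u}) (r : ℕ → ℝ≥0) {V : Type u} [Finite V]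
    (G : SimpleGraph V) : Prop :=
  Monotone r ∧ ∀ a : ℕ, 0 < a →
    ∃ μ : PMF (Set V), μ.support ⊆ deletionSets f G (r a) ∧ IsThin (1 / (a : ℝ)) μ

/-- A class is fractionally `f`-fragile at rate `r` if each graph from the class is. -/
def GraphClass.IsFractionallyFragile (𝒢 : GraphClass.{u}) (f : GraphParameter.{u})
    (r : ℕ → ℝ≥0) : Prop :=
  ∀ (V : Type u) [Finite V] (G : SimpleGraph V), 𝒢 V G → Fragility.IsFractionallyFragile f r G

/-! ### Treedepth -/

/-- A rooted forest with vertex set `V`: every vertex is a root or has a parent, and `depth` is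
the number of edges on the path from a vertex to the root of its tree. The existence of `depth`
says that the parent map has no cycles. -/
structure RootedForest (V : Type u) where
  parent : V → Option V
  depth : V → ℕ
  depth_root : ∀ v, parent v = none → depth v = 0
  depth_child : ∀ v p, parent v = some p → depth v = depth p + 1

/-- `F.IsAncestor u v`: iterating the parent map (zero or more times) from `v` leads to `u`. -/
def RootedForest.IsAncestor {V : Type u} (F : RootedForest V) (u v : V) : Prop :=
  Relation.ReflTransGen (fun x y => F.parent x = some y) v u

/-- There is a rooted forest of depth at most `d - 1` on `V(G)` (that is, every root-to-leaf path
has at most `d` vertices) such that every edge of `G` joins a vertex to one of its ancestors or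
descendants. -/
def HasTreedepthAtMost {V : Type u} (G : SimpleGraph V) (d : ℕ) : Prop :=
  ∃ F : RootedForest V, (∀ v, F.depth v < d) ∧
    ∀ u v, G.Adj u v → F.IsAncestor u v ∨ F.IsAncestor v u

theorem HasTreedepthAtMost.of_iso {V W : Type u} {G : SimpleGraph V} {H : SimpleGraph W}
    (e : G ≃g H) {d : ℕ} (h : HasTreedepthAtMost G d) : HasTreedepthAtMost H d := by
  obtain ⟨F, hd, hF⟩ := h
  refine ⟨⟨fun w => (F.parent (e.symm w)).map e, fun w => F.depth (e.symm w), ?_, ?_⟩, ?_, ?_⟩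
  · intro w hw
    exact F.depth_root _ (by simpa using hw)
  · intro w p hp
    obtain ⟨q, hq, rfl⟩ := Option.map_eq_some_iff.1 hp
    simpa using F.depth_child _ _ hq
  · exact fun w => hd _
  · intro x y hxy
    have key : ∀ x y, F.IsAncestor (e.symm x) (e.symm y) →
        Relation.ReflTransGen (fun x y => (F.parent (e.symm x)).map e = some y) y x := by
      intro x y h
      have := Relation.ReflTransGen.lift (r := fun a b => F.parent a = some b)
        (p := fun x y => (F.parent (e.symm x)).map e = some y) e
        (fun a b hab => by simp [Function.onFun, hab]) _ _ h
      simpa [Function.onFun] using this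
    exact (hF _ _ (e.symm.map_rel_iff.2 hxy)).imp (key _ _) (key _ _)

/-- The minimum is over a nonempty set: a finite graph has a witness, namely a rooted path. -/
theorem exists_hasTreedepthAtMost {V : Type u} [Finite V] (G : SimpleGraph V) :
    ∃ d, HasTreedepthAtMost G d := by
  obtain ⟨n, ⟨e⟩⟩ := Finite.exists_equiv_fin V
  let par : Fin n → Option (Fin n) := fun i =>
    if h : (i : ℕ) = 0 then none else some ⟨i - 1, by omega⟩
  have hpar : ∀ i j, par i = some j → (i : ℕ) = j + 1 := by
    intro i j h
    by_cases h0 : (i : ℕ) = 0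
    · simp [par, h0] at h
    · simp only [par, h0, dite_false, Option.some.injEq] at h
      subst h; simp; omega
  let F : RootedForest V :=
    ⟨fun v => (par (e v)).map e.symm, fun v => e v,
      fun v hv => by
        by_contra h0
        simp [par, h0] at hv,
      fun v p hp => by
        obtain ⟨q, hq, rfl⟩ := Option.map_eq_some_iff.1 hp
        simpa using hpar _ _ hq⟩
  have key : ∀ k : ℕ, ∀ u v : V, (e v : ℕ) = e u + k → F.IsAncestor u v := by
    intro k
    induction k with
    | zero =>
      intro u v h
      have : v = u := e.injective (Fin.ext (by simpa using h))
      subst this; exact Relation.ReflTransGen.refl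
    | succ k ih =>
      intro u v h
      have h0 : (e v : ℕ) ≠ 0 := by omega
      refine Relation.ReflTransGen.head (b := e.symm ⟨e v - 1, by omega⟩) ?_ (ih _ _ ?_)
      · simp [F, par, h0]
      · simp; omega
  refine ⟨n, F, fun v => (e v).2, fun u v _ => ?_⟩
  rcases le_total (e u : ℕ) (e v) with h | h
  · exact Or.inl (key (e v - e u) u v (by omega))
  · exact Or.inr (key (e u - e v) v u (by omega))

/-- The least `d` such that `G` has a treedepth witness of depth at most `d - 1`. -/
noncomputable def treedepth {V : Type u} (G : SimpleGraph V) : ℕ :=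
  sInf {d | HasTreedepthAtMost G d}

/-- Treedepth as a graph parameter. -/
noncomputable def td : GraphParameter.{u} where
  val G := (treedepth G : ℝ≥0)
  val_eq_of_iso G H e := by
    have : {d | HasTreedepthAtMost G d} = {d | HasTreedepthAtMost H d} :=
      Set.ext fun _ => ⟨fun h => h.of_iso e, fun h => h.of_iso e.symm⟩
    simp [treedepth, this]

/-! ### Planar chordal graphs -/

/-- The Euclidean plane. -/
abbrev Plane := EuclideanSpace ℝ (Fin 2)

/-- `A` is a simple arc in the plane with ends `p` and `q`. -/
def IsArc (A : Set Plane) (p q : Plane) : Prop :=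
  ∃ γ : Path p q, Function.Injective γ ∧ Set.range γ = A

/-- `G` can be drawn in the plane: vertices are distinct points, every edge is a simple arc between
its ends that contains no other vertex, and two distinct edges meet only in common ends. -/
def IsPlanar {V : Type u} (G : SimpleGraph V) : Prop :=
  ∃ (point : V → Plane) (arc : Sym2 V → Set Plane),
    Function.Injective point ∧
    (∀ u v, G.Adj u v → IsArc (arc s(u, v)) (point u) (point v)) ∧
    (∀ e ∈ G.edgeSet, ∀ w, point w ∈ arc e → w ∈ e) ∧
    (∀ e ∈ G.edgeSet, ∀ e' ∈ G.edgeSet, e ≠ e' →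
      ∀ x ∈ arc e ∩ arc e', ∃ w, w ∈ e ∧ w ∈ e' ∧ x = point w)

/-- `G` is chordal: it contains no induced cycle other than triangles. -/
def IsChordal {V : Type u} (G : SimpleGraph V) : Prop :=
  ∀ n : ℕ, 4 ≤ n → IsEmpty (SimpleGraph.cycleGraph n ↪g G)

/-- The class of planar chordal graphs. -/
def planarChordal : GraphClass.{u} := fun _ _ G => IsPlanar G ∧ IsChordal G

end Fragility

namespace Fragility

/-! Split `G` into distance layers from a root of each component and delete every `2a`-th layer. If
two vertices of a layer are attached to one connected part of the farther layers, they are also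
joined through the nearer layers, so chordality makes them equal or adjacent
(`IsLayering.eq_or_adj`). Excursions into farther layers can therefore be shortcut, and rankings of
the single layers, ordered lexicographically after the residue of the layer, form a ranking of what
remains (`IsLayering.ranked`). This costs a factor `2a`; rankings bound treedepth
(`Ranked.hasTreedepthAtMost`).

The layers are chordal, so they can be layered again, now with modulus `4a`. After two layerings
only paths are left: the nearer layers of the two layerings provide two hubs seen by a vertex and
all its neighbours, so a triangle would yield `K₅` and a vertex of degree three `K₃,₃`. Both are
excluded by a parity count of winding numbers. A path with every `4a`-th vertex deleted is ranked by
2-adic valuation with `t = 2 + ⌈log₂ a⌉` values, since `4a ≤ 2 ^ t`. The total is `2a · 4a · t`.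

All three deletions use one uniform offset modulo `4a`. A vertex is deleted for at most `2 + 1 + 1`
of the `4a` offsets, hence with probability at most `1/a`. -/

/-! ### Winding numbers and the nonplanarity of `K₅` and `K₃,₃`. -/

theorem exists_continuous_log {X : Type*} [TopologicalSpace X] [SimplyConnectedSpace X]
    [LocallyPathConnectedSpace X] (g : X → ℂ) (hg : Continuous g) (h0 : ∀ x, g x ≠ 0) :
    ∃ L : X → ℂ, Continuous L ∧ ∀ x, Complex.exp (L x) = g x := by
  obtain ⟨x₀⟩ : Nonempty X := inferInstance
  obtain ⟨L, ⟨-, hL⟩, -⟩ := Complex.isCoveringMapOn_exp.existsUnique_continuousMap_lifts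
    ⟨g, hg⟩ (a₀ := x₀) (Complex.exp_log (h0 x₀)) (fun x => h0 x)
  exact ⟨L, L.continuous, fun x => congrFun hL x⟩

/-- Two continuous logarithms of the same function have the same increments. -/
theorem log_increment_unique {L L' : ℝ → ℂ} (hL : Continuous L) (hL' : Continuous L')
    (h : ∀ x, Complex.exp (L x) = Complex.exp (L' x)) (x y : ℝ) :
    L y - L x = L' y - L' x := by
  have key : ∀ z, ∃ n : ℤ, L z = L' z + n * (2 * Real.pi * Complex.I) := fun z =>
    Complex.exp_eq_exp_iff_exists_int.1 (h z)
  choose n hn using key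
  have hpi : (2 * Real.pi * Complex.I : ℂ) ≠ 0 := Complex.two_pi_I_ne_zero
  have hcont : Continuous fun z => ((n z : ℝ)) := by
    have : (fun z => (n z : ℝ)) = fun z => ((L z - L' z) / (2 * Real.pi * Complex.I)).re := by
      funext z
      rw [hn z, add_sub_cancel_left, mul_div_cancel_right₀ _ hpi]
      simp
    rw [this]
    exact Complex.continuous_re.comp ((hL.sub hL').div_const _)
  have hn' : Continuous n := Int.isClosedEmbedding_coe_real.isInducing.continuous_iff.2 hcont
  have hc : n x = n y := PreconnectedSpace.constant inferInstance hn'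
  rw [hn x, hn y, hc]; ring

/-- The increment between `0` and `1` of a continuous logarithm of `γ`. -/
noncomputable def logIncrement (γ : ℝ → ℂ) : ℂ := by
  classical
  exact if h : ∃ L : ℝ → ℂ, Continuous L ∧ ∀ x, Complex.exp (L x) = γ x then
    h.choose 1 - h.choose 0 else 0

theorem logIncrement_eq {γ L : ℝ → ℂ} (hL : Continuous L) (h : ∀ x, Complex.exp (L x) = γ x) :
    logIncrement γ = L 1 - L 0 := by
  have hex : ∃ L : ℝ → ℂ, Continuous L ∧ ∀ x, Complex.exp (L x) = γ x := ⟨L, hL, h⟩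
  rw [logIncrement, dif_pos hex]
  exact log_increment_unique hex.choose_spec.1 hL
    (fun x => (hex.choose_spec.2 x).trans (h x).symm) 0 1

/-- The function `σ s - τ t` has a continuous logarithm on the whole plane of parameters, so its
increments around the unit square cancel. -/
theorem logIncrement_square {σ τ : ℝ → ℂ} (hσ : Continuous σ) (hτ : Continuous τ)
    (h : ∀ s t, σ s ≠ τ t) :
    logIncrement (fun s => σ s - τ 1) - logIncrement (fun s => σ s - τ 0) =
      logIncrement (fun t => τ t - σ 1) - logIncrement (fun t => τ t - σ 0) := by
  obtain ⟨L, hL, hexp⟩ := exists_continuous_log (X := ℝ × ℝ) (fun p => σ p.1 - τ p.2)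
    (by fun_prop) (fun p => sub_ne_zero.2 (h _ _))
  have h1 : ∀ t, logIncrement (fun s => σ s - τ t) = L (1, t) - L (0, t) := fun t =>
    logIncrement_eq (L := fun s => L (s, t)) (by fun_prop) (fun s => hexp (s, t))
  have h2 : ∀ s, logIncrement (fun t => τ t - σ s) = L (s, 1) - L (s, 0) := by
    intro s
    -- The constant `π i` accounts for the sign in `τ t - σ s` and drops out of the increment.
    rw [logIncrement_eq (L := fun t => L (s, t) + Real.pi * Complex.I) (by fun_prop)]
    · ring
    · intro t
      rw [Complex.exp_add, Complex.exp_pi_mul_I, hexp]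
      simp
  rw [h1, h1, h2, h2]; ring

/-- A family of logarithms of the differences of points that is antisymmetric up to `π i`. -/
noncomputable def diffLog {n : ℕ} (pt : Fin n → ℂ) (u v : Fin n) : ℂ :=
  if u < v then Complex.log (pt u - pt v) else Complex.log (pt v - pt u) + Real.pi * Complex.I

theorem exp_diffLog {n : ℕ} {pt : Fin n → ℂ} (hpt : Function.Injective pt) {u v : Fin n}
    (h : u ≠ v) : Complex.exp (diffLog pt u v) = pt u - pt v := by
  have h1 : pt u - pt v ≠ 0 := sub_ne_zero.2 (hpt.ne h)
  have h2 : pt v - pt u ≠ 0 := sub_ne_zero.2 (hpt.ne h.symm)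
  unfold diffLog
  split_ifs
  · exact Complex.exp_log h1
  · rw [Complex.exp_add, Complex.exp_pi_mul_I, Complex.exp_log h2]; ring

/-- `1` or `-1` according to the order of the two indices. -/
def orderSign {n : ℕ} (u v : Fin n) : ℤ := if u < v then 1 else -1

theorem diffLog_swap {n : ℕ} (pt : Fin n → ℂ) {u v : Fin n} (h : u ≠ v) :
    diffLog pt v u = diffLog pt u v + orderSign u v * (Real.pi * Complex.I) := by
  unfold diffLog orderSign
  rcases lt_or_gt_of_ne h with h | h
  · simp [h, h.not_gt]
  · simp [h, h.not_gt]

/-- The integral form of the van Kampen cocycle identity for a drawing in which disjoint edges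
do not cross. -/
theorem exists_crossing_cochain {n : ℕ} {pt : Fin n → ℂ} (hpt : Function.Injective pt)
    (E : Fin n → Fin n → Prop) (γ : Fin n → Fin n → ℝ → ℂ)
    (hγ : ∀ a b, E a b → Continuous (γ a b) ∧ γ a b 0 = pt a ∧ γ a b 1 = pt b)
    (hdisj : ∀ a b c d, E a b → E c d → a ≠ c → a ≠ d → b ≠ c → b ≠ d →
      ∀ s t, γ a b s ≠ γ c d t) :
    ∃ N : Fin n → Fin n → Fin n → ℤ, ∀ a b c d, E a b → E c d → a ≠ c → a ≠ d → b ≠ c → b ≠ d →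
      2 * (N a b d - N a b c - N c d b + N c d a) =
        orderSign b d - orderSign a d - orderSign b c + orderSign a c := by
  -- `k` counts the turns of the edge around `v`, relative to the logarithms fixed at its ends.
  have key : ∀ a b v, ∃ k : ℤ, E a b → a ≠ v → b ≠ v → (∀ s, γ a b s ≠ pt v) →
      logIncrement (fun s => γ a b s - pt v) =
        diffLog pt b v - diffLog pt a v + k * (2 * Real.pi * Complex.I) := by
    intro a b v
    by_cases h : E a b ∧ a ≠ v ∧ b ≠ v ∧ (∀ s, γ a b s ≠ pt v)
    · obtain ⟨hE, hav, hbv, hne⟩ := h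
      obtain ⟨hc, h0, h1⟩ := hγ a b hE
      obtain ⟨L, hL, hexp⟩ := exists_continuous_log (fun s => γ a b s - pt v) (by fun_prop)
        (fun s => sub_ne_zero.2 (hne s))
      obtain ⟨k₀, hk₀⟩ := Complex.exp_eq_exp_iff_exists_int.1
        ((hexp 0).trans (by rw [h0, exp_diffLog hpt hav]))
      obtain ⟨k₁, hk₁⟩ := Complex.exp_eq_exp_iff_exists_int.1
        ((hexp 1).trans (by rw [h1, exp_diffLog hpt hbv]))
      refine ⟨k₁ - k₀, fun _ _ _ _ => ?_⟩
      rw [logIncrement_eq hL hexp, hk₀, hk₁]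
      push_cast; ring
    · exact ⟨0, fun h1 h2 h3 h4 => (h ⟨h1, h2, h3, h4⟩).elim⟩
  choose N hN using key
  refine ⟨N, fun a b c d hab hcd hac had hbc hbd => ?_⟩
  obtain ⟨hσ, hσ0, hσ1⟩ := hγ a b hab
  obtain ⟨hτ, hτ0, hτ1⟩ := hγ c d hcd
  have hne := hdisj a b c d hab hcd hac had hbc hbd
  have hsq := logIncrement_square hσ hτ hne
  rw [hσ0, hσ1, hτ0, hτ1, hN a b d hab had hbd (fun s => hτ1 ▸ hne s 1),
    hN a b c hab hac hbc (fun s => hτ0 ▸ hne s 0),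
    hN c d b hcd hbc.symm hbd.symm (fun s => hσ1 ▸ (hne 1 s).symm),
    hN c d a hcd hac.symm had.symm (fun s => hσ0 ▸ (hne 0 s).symm),
    diffLog_swap pt hbd, diffLog_swap pt hbc, diffLog_swap pt had, diffLog_swap pt hac] at hsq
  have hpi : (Real.pi * Complex.I : ℂ) ≠ 0 := by simp [Real.pi_ne_zero]
  have h3 : (Real.pi * Complex.I : ℂ) * (2 * (N a b d - N a b c - N c d b + N c d a)) =
      (Real.pi * Complex.I : ℂ) *
        (orderSign b d - orderSign a d - orderSign b c + orderSign a c) := by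
    linear_combination hsq
  exact_mod_cast mul_left_cancel₀ hpi h3

/-- There is no drawing of `K₅` in the plane such that disjoint edges do not cross. -/
theorem not_drawing_completeGraph_five {pt : Fin 5 → ℂ} (hpt : Function.Injective pt)
    (γ : Fin 5 → Fin 5 → ℝ → ℂ)
    (hγ : ∀ a b, a < b → Continuous (γ a b) ∧ γ a b 0 = pt a ∧ γ a b 1 = pt b)
    (hdisj : ∀ a b c d, a < b → c < d → a ≠ c → a ≠ d → b ≠ c → b ≠ d →
      ∀ s t, γ a b s ≠ γ c d t) : False := by
  obtain ⟨N, hN⟩ := exists_crossing_cochain hpt (· < ·) γ hγ hdisj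
  -- Over the 15 pairs of disjoint edges, each `N a b v` occurs an even number of times (twice),
  -- while half the right-hand side is odd exactly for the 5 pairs with interlaced ends: a parity
  -- contradiction.
  have h1 := hN 0 1 2 3
  have h2 := hN 0 1 2 4
  have h3 := hN 0 1 3 4
  have h4 := hN 0 2 1 3
  have h5 := hN 0 2 1 4
  have h6 := hN 0 2 3 4
  have h7 := hN 0 3 1 2
  have h8 := hN 0 3 1 4
  have h9 := hN 0 3 2 4
  have h10 := hN 0 4 1 2
  have h11 := hN 0 4 1 3
  have h12 := hN 0 4 2 3
  have h13 := hN 1 2 3 4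
  have h14 := hN 1 3 2 4
  have h15 := hN 1 4 2 3
  simp [orderSign] at h1 h2 h3 h4 h5 h6 h7 h8 h9 h10 h11 h12 h13 h14 h15
  omega

/-- There is no drawing of `K₃,₃` in the plane such that disjoint edges do not cross. -/
theorem not_drawing_completeBipartite_three_three {pt : Fin 6 → ℂ} (hpt : Function.Injective pt)
    (γ : Fin 6 → Fin 6 → ℝ → ℂ)
    (hγ : ∀ a b, a < 3 → 3 ≤ b → Continuous (γ a b) ∧ γ a b 0 = pt a ∧ γ a b 1 = pt b)
    (hdisj : ∀ a b c d, a < 3 → 3 ≤ b → c < 3 → 3 ≤ d → a ≠ c → b ≠ d →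
      ∀ s t, γ a b s ≠ γ c d t) : False := by
  obtain ⟨N, hN⟩ := exists_crossing_cochain hpt (fun a b => a < 3 ∧ 3 ≤ b) γ
    (fun a b h => hγ a b h.1 h.2)
    (fun a b c d h h' hac _ _ hbd => hdisj a b c d h.1 h.2 h'.1 h'.2 hac hbd)
  -- The same parity count: 18 pairs, of which 9 are interlaced, and each `N a b v` occurs twice.
  have h1 := hN 0 3 1 4
  have h2 := hN 0 3 1 5
  have h3 := hN 0 4 1 3
  have h4 := hN 0 4 1 5
  have h5 := hN 0 5 1 3
  have h6 := hN 0 5 1 4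
  have h7 := hN 0 3 2 4
  have h8 := hN 0 3 2 5
  have h9 := hN 0 4 2 3
  have h10 := hN 0 4 2 5
  have h11 := hN 0 5 2 3
  have h12 := hN 0 5 2 4
  have h13 := hN 1 3 2 4
  have h14 := hN 1 3 2 5
  have h15 := hN 1 4 2 3
  have h16 := hN 1 4 2 5
  have h17 := hN 1 5 2 3
  have h18 := hN 1 5 2 4
  simp [orderSign] at h1 h2 h3 h4 h5 h6 h7 h8 h9 h10 h11 h12 h13 h14 h15 h16 h17 h18
  omega

/-! ### Walks inside vertex sets, and drawings obtained from models. -/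

/-- `u` and `v` are joined by a walk of `G` inside `T`. -/
def ReachIn {V : Type u} (G : SimpleGraph V) (T : Set V) : V → V → Prop :=
  Relation.ReflTransGen fun x y => G.Adj x y ∧ x ∈ T ∧ y ∈ T

theorem ReachIn.mono {V : Type u} {G H : SimpleGraph V} {S T : Set V} {u v : V}
    (h : ReachIn G S u v) (hGH : ∀ x y, x ∈ S → y ∈ S → G.Adj x y → H.Adj x y) (hST : S ⊆ T) :
    ReachIn H T u v :=
  Relation.ReflTransGen.mono
    (fun x y hxy => ⟨hGH x y hxy.2.1 hxy.2.2 hxy.1, hST hxy.2.1, hST hxy.2.2⟩) _ _ h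

theorem ReachIn.symm {V : Type u} {G : SimpleGraph V} {T : Set V} {u v : V}
    (h : ReachIn G T u v) : ReachIn G T v u := by
  induction h with
  | refl => exact .refl
  | tail _ h ih => exact .head ⟨h.1.symm, h.2.2, h.2.1⟩ ih

/-- The constant walk is allowed even at a vertex outside `T`, hence the hypothesis on `u`. -/
theorem ReachIn.mem_right {V : Type u} {G : SimpleGraph V} {T : Set V} {u v : V}
    (h : ReachIn G T u v) (hu : u ∈ T) : v ∈ T := by
  induction h with
  | refl => exact hu
  | tail _ h _ => exact h.2.2

/-- A drawing of `G` in the plane, as in the definition of planarity. -/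
structure IsDrawing {V : Type u} (G : SimpleGraph V) (point : V → Plane)
    (arc : Sym2 V → Set Plane) : Prop where
  inj : Function.Injective point
  isArc : ∀ u v, G.Adj u v → IsArc (arc s(u, v)) (point u) (point v)
  point_mem : ∀ e ∈ G.edgeSet, ∀ w, point w ∈ arc e → w ∈ e
  inter : ∀ e ∈ G.edgeSet, ∀ e' ∈ G.edgeSet, e ≠ e' →
    ∀ x ∈ arc e ∩ arc e', ∃ w, w ∈ e ∧ w ∈ e' ∧ x = point w

/-- The part of the plane covered by the drawing of the subgraph induced by `T`. -/
def drawn {V : Type u} (G : SimpleGraph V) (point : V → Plane) (arc : Sym2 V → Set Plane)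
    (T : Set V) : Set Plane :=
  {x | (∃ v ∈ T, x = point v) ∨ ∃ u ∈ T, ∃ v ∈ T, G.Adj u v ∧ x ∈ arc s(u, v)}

theorem IsDrawing.disjoint_drawn {V : Type u} {G : SimpleGraph V} {point : V → Plane}
    {arc : Sym2 V → Set Plane} (h : IsDrawing G point arc) {S T : Set V} (hST : Disjoint S T) :
    Disjoint (drawn G point arc S) (drawn G point arc T) := by
  have hne : ∀ x ∈ S, ∀ y ∈ T, x ≠ y := fun x hx y hy hxy =>
    Set.disjoint_left.1 hST hx (hxy ▸ hy)
  rw [Set.disjoint_left]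
  rintro x (⟨u, hu, rfl⟩ | ⟨u, hu, v, hv, huv, hx⟩) (⟨w, hw, hxw⟩ | ⟨w, hw, z, hz, hwz, hx'⟩)
  · exact hne _ hu _ hw (h.inj hxw)
  · have := h.point_mem _ ((SimpleGraph.mem_edgeSet G).2 hwz) u hx'
    rcases Sym2.mem_iff.1 this with e | e
    · exact hne _ hu _ hw e
    · exact hne _ hu _ hz e
  · subst hxw
    have := h.point_mem _ ((SimpleGraph.mem_edgeSet G).2 huv) w hx
    rcases Sym2.mem_iff.1 this with e | e
    · exact hne _ hu _ hw e.symm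
    · exact hne _ hv _ hw e.symm
  · have hee : s(u, v) ≠ s(w, z) := by
      intro e
      have : u ∈ s(w, z) := e ▸ Sym2.mem_mk_left u v
      rcases Sym2.mem_iff.1 this with e | e
      · exact hne _ hu _ hw e
      · exact hne _ hu _ hz e
    obtain ⟨y, hy, hy', -⟩ := h.inter _ ((SimpleGraph.mem_edgeSet G).2 huv) _
      ((SimpleGraph.mem_edgeSet G).2 hwz) hee x ⟨hx, hx'⟩
    rcases Sym2.mem_iff.1 hy with rfl | rfl <;> rcases Sym2.mem_iff.1 hy' with rfl | rfl
    · exact hne _ hu _ hw rfl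
    · exact hne _ hu _ hz rfl
    · exact hne _ hv _ hw rfl
    · exact hne _ hv _ hz rfl

theorem IsDrawing.joinedIn {V : Type u} {G : SimpleGraph V} {point : V → Plane}
    {arc : Sym2 V → Set Plane} (h : IsDrawing G point arc) {T : Set V} {u v : V} (hu : u ∈ T)
    (huv : ReachIn G T u v) : JoinedIn (drawn G point arc T) (point u) (point v) := by
  induction huv with
  | refl => exact JoinedIn.refl (Or.inl ⟨u, hu, rfl⟩)
  | @tail x y _ hxy ih =>
    refine ih.trans ?_
    obtain ⟨γ, -, hγ⟩ := h.isArc x y hxy.1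
    exact ⟨γ, fun t => Or.inr ⟨x, hxy.2.1, y, hxy.2.2, hxy.1, hγ ▸ ⟨t, rfl⟩⟩⟩

/-- The Euclidean plane as the complex numbers. -/
noncomputable def planeToComplex (p : Plane) : ℂ := ⟨p 0, p 1⟩

theorem planeToComplex_injective : Function.Injective planeToComplex := by
  intro p q h
  have h0 : p 0 = q 0 := congrArg Complex.re h
  have h1 : p 1 = q 1 := congrArg Complex.im h
  ext i
  fin_cases i
  · exact h0
  · exact h1

theorem continuous_planeToComplex : Continuous planeToComplex := by
  have : planeToComplex = fun p : Plane => ((p 0 : ℝ) : ℂ) + (p 1 : ℝ) * Complex.I := by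
    funext p
    apply Complex.ext <;> simp [planeToComplex]
  rw [this]
  fun_prop

/-- Vertices `b 0, …, b (n-1)` in pairwise disjoint vertex sets `B i`, such that `b i` and `b j`
are joined inside `B i ∪ B j` whenever `E i j`: a sort of minor model. -/
structure IsModel {V : Type u} (G : SimpleGraph V) {n : ℕ} (E : Fin n → Fin n → Prop)
    (B : Fin n → Set V) (b : Fin n → V) : Prop where
  mem : ∀ i, b i ∈ B i
  disj : ∀ i j, i ≠ j → Disjoint (B i) (B j)
  reach : ∀ i j, E i j → ReachIn G (B i ∪ B j) (b i) (b j)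

/-- Each edge `i j` follows a walk inside `B i ∪ B j`. Curves of edges with a common end may overlap
freely, but disjoint edges use disjoint parts of the drawing, which is all the parity argument
needs. The sets `B i` need not be connected. -/
theorem IsModel.exists_drawing {V : Type u} {G : SimpleGraph V} (hG : IsPlanar G) {n : ℕ}
    {E : Fin n → Fin n → Prop} {B : Fin n → Set V} {b : Fin n → V} (hB : IsModel G E B b) :
    ∃ pt : Fin n → ℂ, Function.Injective pt ∧ ∃ γ : Fin n → Fin n → ℝ → ℂ,
      (∀ i j, E i j → Continuous (γ i j) ∧ γ i j 0 = pt i ∧ γ i j 1 = pt j) ∧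
      ∀ i j k l, E i j → E k l → i ≠ k → i ≠ l → j ≠ k → j ≠ l →
        ∀ s t, γ i j s ≠ γ k l t := by
  obtain ⟨point, arc, h1, h2, h3, h4⟩ := hG
  have hD : IsDrawing G point arc := ⟨h1, h2, h3, h4⟩
  have hb : Function.Injective b := by
    intro i j hij
    by_contra hne
    exact Set.disjoint_left.1 (hB.disj i j hne) (hB.mem i) (hij ▸ hB.mem j)
  have key : ∀ i j, ∃ γ : ℝ → Plane, E i j →
      Continuous γ ∧ γ 0 = point (b i) ∧ γ 1 = point (b j) ∧
      ∀ s, γ s ∈ drawn G point arc (B i ∪ B j) := by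
    intro i j
    by_cases h : E i j
    · obtain ⟨p, hp⟩ := hD.joinedIn (Or.inl (hB.mem i)) (hB.reach i j h)
      refine ⟨p.extend, fun _ => ⟨p.continuous_extend, p.extend_zero, p.extend_one, fun s => ?_⟩⟩
      exact hp _
    · exact ⟨fun _ => 0, fun h' => (h h').elim⟩
  choose γ hγ using key
  refine ⟨fun i => planeToComplex (point (b i)),
    planeToComplex_injective.comp (hD.inj.comp hb), fun i j s => planeToComplex (γ i j s), ?_, ?_⟩
  · intro i j h
    obtain ⟨hc, h0, h1, -⟩ := hγ i j h
    exact ⟨continuous_planeToComplex.comp hc, congrArg _ h0, congrArg _ h1⟩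
  · intro i j k l hij hkl hik hil hjk hjl s t hst
    refine Set.disjoint_left.1 (hD.disjoint_drawn (S := B i ∪ B j) (T := B k ∪ B l) ?_)
      ((hγ i j hij).2.2.2 s) (planeToComplex_injective hst ▸ (hγ k l hkl).2.2.2 t)
    simp only [Set.disjoint_union_left, Set.disjoint_union_right]
    exact ⟨⟨hB.disj _ _ hik, hB.disj _ _ hjk⟩, hB.disj _ _ hil, hB.disj _ _ hjl⟩

theorem IsPlanar.not_model_completeGraph_five {V : Type u} {G : SimpleGraph V} (hG : IsPlanar G)
    {B : Fin 5 → Set V} {b : Fin 5 → V} (hB : IsModel G (· < ·) B b) : False := by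
  obtain ⟨pt, hpt, γ, hγ, hd⟩ := hB.exists_drawing hG
  exact not_drawing_completeGraph_five hpt γ hγ hd

theorem IsPlanar.not_model_completeBipartite_three_three {V : Type u} {G : SimpleGraph V}
    (hG : IsPlanar G) {B : Fin 6 → Set V} {b : Fin 6 → V}
    (hB : IsModel G (fun i j => i < 3 ∧ 3 ≤ j) B b) : False := by
  obtain ⟨pt, hpt, γ, hγ, hd⟩ := hB.exists_drawing hG
  refine not_drawing_completeBipartite_three_three hpt γ (fun i j hi hj => hγ i j ⟨hi, hj⟩) ?_
  intro i j k l hi hj hk hl hik hjl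
  exact hd i j k l ⟨hi, hj⟩ ⟨hk, hl⟩ hik (hi.trans_le hl).ne (hk.trans_le hj).ne' hjl

/-! ### Induced paths and cycles in chordal graphs. -/

/-- The edges of `G` inside `T`. -/
def within {V : Type u} (G : SimpleGraph V) (T : Set V) : SimpleGraph V where
  Adj x y := G.Adj x y ∧ x ∈ T ∧ y ∈ T
  symm := ⟨fun _ _ h => ⟨h.1.symm, h.2.2, h.2.1⟩⟩
  loopless := ⟨fun _ h => h.1.ne rfl⟩

/-- A shortest walk in `within G T` works: `p i` is at distance `i` from `u`, which excludes
repetitions and chords. -/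
theorem ReachIn.exists_induced_path {V : Type u} {G : SimpleGraph V} {T : Set V} {u v : V}
    (hu : u ∈ T) (h : ReachIn G T u v) :
    ∃ (k : ℕ) (p : ℕ → V), p 0 = u ∧ p k = v ∧ (∀ i, p i ∈ T) ∧
      (∀ i < k, G.Adj (p i) (p (i + 1))) ∧
      (∀ i ≤ k, ∀ j ≤ k, p i = p j → i = j) ∧
      (∀ i ≤ k, ∀ j ≤ k, G.Adj (p i) (p j) → i ≤ j + 1) := by
  set K := within G T with hK
  have hreach : K.Reachable u v :=
    (SimpleGraph.reachable_iff_reflTransGen u v).2 h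
  obtain ⟨w, hw⟩ := hreach.exists_walk_length_eq_dist
  have hadj : ∀ i < w.length, K.Adj (w.getVert i) (w.getVert (i + 1)) := fun i hi =>
    w.adj_getVert_succ hi
  have hdist : ∀ i ≤ w.length, K.dist u (w.getVert i) = i := by
    intro i hi
    have h1 : K.dist u (w.getVert i) ≤ i :=
      (SimpleGraph.dist_le (w.take i)).trans (by simp)
    have h2 : K.dist (w.getVert i) v ≤ w.length - i :=
      (SimpleGraph.dist_le (w.drop i)).trans (by simp)
    have h3 : K.dist u v ≤ K.dist u (w.getVert i) + K.dist (w.getVert i) v :=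
      (w.take i).reachable.dist_triangle_left _
    omega
  have hT : ∀ i, w.getVert i ∈ T := fun i =>
    ReachIn.mem_right (G := G) (T := T)
      ((SimpleGraph.reachable_iff_reflTransGen _ _).1 (w.take i).reachable) hu
  refine ⟨w.length, w.getVert, w.getVert_zero, w.getVert_length, hT,
    fun i hi => (hadj i hi).1, fun i hi j hj hij => ?_, fun i hi j hj hij => ?_⟩
  · rw [← hdist i hi, ← hdist j hj, hij]
  · have h1 : K.Adj (w.getVert j) (w.getVert i) := ⟨hij.symm, hT j, hT i⟩
    have h2 : K.dist u (w.getVert i) ≤ K.dist u (w.getVert j) + K.dist (w.getVert j) (w.getVert i) :=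
      (w.take j).reachable.dist_triangle_left _
    rw [hdist i hi, hdist j hj, SimpleGraph.dist_eq_one_iff_adj.2 h1] at h2
    exact h2

theorem cycleGraph_adj_iff_of_lt {n : ℕ} {i j : Fin n} (h : i < j) :
    (SimpleGraph.cycleGraph n).Adj i j ↔
      (j : ℕ) = i + 1 ∨ ((i : ℕ) = 0 ∧ (j : ℕ) + 1 = n) := by
  rw [SimpleGraph.cycleGraph_adj', Fin.coe_sub_iff_lt.2 h, Fin.coe_sub_iff_le.2 h.le]
  have := i.2; have := j.2; have : (i : ℕ) < j := h
  omega

/-- In a chordal graph, a pair of vertices joined through two anticomplete sets is adjacent. -/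
theorem IsChordal.adj_of_reachIn {V : Type u} {G : SimpleGraph V} (hG : IsChordal G)
    {A B : Set V} {z y : V} (hzy : z ≠ y) (hAB : ∀ a ∈ A, ∀ b ∈ B, a ≠ b ∧ ¬ G.Adj a b)
    (hA : ReachIn G (insert z (insert y A)) z y) (hB : ReachIn G (insert z (insert y B)) z y) :
    G.Adj z y := by
  by_contra hnadj
  obtain ⟨k, p, hp0, hpk, hpT, hpa, hpi, hpn⟩ := hA.exists_induced_path (Set.mem_insert _ _)
  obtain ⟨l, q, hq0, hql, hqT, hqa, hqi, hqn⟩ := hB.exists_induced_path (Set.mem_insert _ _)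
  have two_le : ∀ (k : ℕ) (p : ℕ → V), p 0 = z → p k = y → (∀ i < k, G.Adj (p i) (p (i + 1))) →
      2 ≤ k := by
    intro k p h0 hk ha
    by_contra hlt
    obtain rfl | rfl : k = 0 ∨ k = 1 := by omega
    · exact hzy (h0.symm.trans hk)
    · exact hnadj (by simpa [h0, hk] using ha 0 one_pos)
  have hk2 := two_le k p hp0 hpk hpa
  have hl2 := two_le l q hq0 hql hqa
  have hpA : ∀ i, 0 < i → i < k → p i ∈ A := by
    intro i h0 hik
    rcases hpT i with h | h | h
    · have := hpi i hik.le 0 (by omega) (h.trans hp0.symm); omega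
    · have := hpi i hik.le k le_rfl (h.trans hpk.symm); omega
    · exact h
  have hqB : ∀ i, 0 < i → i < l → q i ∈ B := by
    intro i h0 hil
    rcases hqT i with h | h | h
    · have := hqi i hil.le 0 (by omega) (h.trans hq0.symm); omega
    · have := hqi i hil.le l le_rfl (h.trans hql.symm); omega
    · exact h
  have hpadj : ∀ i j, i < j → j ≤ k → (p i ≠ p j ∧ (G.Adj (p i) (p j) ↔ j = i + 1)) := by
    intro i j hij hj
    refine ⟨fun h => ?_, fun h => ?_, fun h => h ▸ hpa i (by omega)⟩
    · have := hpi i (by omega) j hj h; omega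
    · have := hpn j hj i (by omega) h.symm; omega
  have hqadj : ∀ i j, i < j → j ≤ l → (q i ≠ q j ∧ (G.Adj (q i) (q j) ↔ j = i + 1)) := by
    intro i j hij hj
    refine ⟨fun h => ?_, fun h => ?_, fun h => h ▸ hqa i (by omega)⟩
    · have := hqi i (by omega) j hj h; omega
    · have := hqn j hj i (by omega) h.symm; omega
  -- Forward along `p` from `z` to `y`, back along `q`. Both paths have length at least 2, so the
  -- cycle has length at least 4; it is induced because `A` and `B` are anticomplete.
  let f : Fin (k + l) → V := fun i => if (i : ℕ) ≤ k then p i else q (k + l - i)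
  have key : ∀ i j : Fin (k + l), i < j → f i ≠ f j ∧
      (G.Adj (f i) (f j) ↔ (SimpleGraph.cycleGraph (k + l)).Adj i j) := by
    intro i j hij
    rw [cycleGraph_adj_iff_of_lt hij]
    obtain ⟨i, hi⟩ := i
    obtain ⟨j, hj⟩ := j
    have hij : i < j := hij
    simp only [f]
    by_cases hjk : j ≤ k
    · rw [if_pos hjk, if_pos (by omega)]
      obtain ⟨h1, h2⟩ := hpadj i j hij hjk
      refine ⟨h1, h2.trans ?_⟩
      omega
    · rw [if_neg hjk]
      by_cases hik : i ≤ k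
      · rw [if_pos hik]
        rcases Nat.eq_zero_or_pos i with rfl | hi0
        · rw [hp0, ← hq0]
          obtain ⟨h1, h2⟩ := hqadj 0 (k + l - j) (by omega) (by omega)
          exact ⟨h1, h2.trans (by omega)⟩
        · rcases hik.eq_or_lt with rfl | hik
          · rw [hpk, ← hql]
            obtain ⟨h1, h2⟩ := hqadj (i + l - j) l (by omega) le_rfl
            refine ⟨h1.symm, (G.adj_comm _ _).trans (h2.trans (by omega))⟩
          · obtain ⟨h1, h2⟩ := hAB _ (hpA i hi0 hik) _ (hqB (k + l - j) (by omega) (by omega))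
            exact ⟨h1, ⟨fun h => (h2 h).elim, fun h => by omega⟩⟩
      · rw [if_neg hik]
        obtain ⟨h1, h2⟩ := hqadj (k + l - j) (k + l - i) (by omega) (by omega)
        exact ⟨h1.symm, (G.adj_comm _ _).trans (h2.trans (by omega))⟩
  have hinj : Function.Injective f := by
    intro i j h
    rcases lt_trichotomy i j with hij | hij | hij
    · exact ((key i j hij).1 h).elim
    · exact hij
    · exact ((key j i hij).1 h.symm).elim
  refine (hG (k + l) (by omega)).false ⟨⟨f, hinj⟩, ?_⟩
  intro i j
  simp only [Function.Embedding.coeFn_mk]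
  rcases lt_trichotomy i j with hij | rfl | hij
  · exact (key i j hij).2
  · simp
  · rw [G.adj_comm, SimpleGraph.adj_comm _ i j]
    exact (key j i hij).2

/-! ### Distance layerings. -/

/-- A layering of `G` by the distance from a root vertex of each component. -/
structure IsLayering {V : Type u} (G : SimpleGraph V) (lam : V → ℕ) (root : V → V) : Prop where
  adj_le : ∀ u v, G.Adj u v → lam u ≤ lam v + 1
  root_eq : ∀ u v, G.Adj u v → root u = root v
  eq_root : ∀ v, lam v = 0 → root v = v
  exists_parent : ∀ v, lam v ≠ 0 → ∃ w, G.Adj v w ∧ lam w + 1 = lam v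

theorem isLayering_dist {V : Type u} {G : SimpleGraph V} {root : V → V}
    (hr : ∀ v, G.Reachable (root v) v) (hadj : ∀ u v, G.Adj u v → root u = root v) :
    IsLayering G (fun v => G.dist (root v) v) root where
  root_eq := hadj
  adj_le u v huv := by
    have h := (hr v).dist_triangle_left u
    rw [hadj u v huv]
    rw [SimpleGraph.dist_eq_one_iff_adj.2 huv.symm] at h
    exact h
  eq_root v hv := (hr v).dist_eq_zero_iff.1 hv
  exists_parent v hv := by
    obtain ⟨w, hw⟩ := (hr v).symm.exists_walk_length_eq_dist
    rw [SimpleGraph.dist_comm] at hw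
    have aux : ∀ r (w : G.Walk v r), w.length ≠ 0 →
        ∃ x, G.Adj v x ∧ ∃ q : G.Walk x r, q.length + 1 = w.length := by
      intro r w hw
      cases w with
      | nil => exact (hw rfl).elim
      | cons h q => exact ⟨_, h, q, rfl⟩
    obtain ⟨x, h, q, hq⟩ := aux _ w (by omega)
    refine ⟨x, h, ?_⟩
    have h1 : G.dist (root v) x ≤ q.length := by
      rw [SimpleGraph.dist_comm]; exact SimpleGraph.dist_le q
    have h3 : G.dist (root v) v ≤ G.dist (root v) x + G.dist x v :=
      ((hr v).trans h.reachable).dist_triangle_left v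
    rw [SimpleGraph.dist_eq_one_iff_adj.2 h.symm] at h3
    rw [← hadj v x h]
    omega

theorem exists_isLayering {V : Type u} (G : SimpleGraph V) :
    ∃ lam root, IsLayering G lam root :=
  ⟨_, _, isLayering_dist (G := G) (root := fun v => (G.connectedComponentMk v).out)
    (fun v => SimpleGraph.ConnectedComponent.exact (Quot.out_eq _))
    (fun _ _ h => by rw [SimpleGraph.ConnectedComponent.sound h.reachable])⟩

namespace IsLayering

variable {V : Type u} {G : SimpleGraph V} {lam : V → ℕ} {root : V → V}

theorem reach_root (h : IsLayering G lam root) (v : V) :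
    ReachIn G (insert v {w | lam w < lam v}) v (root v) := by
  induction hk : lam v using Nat.strong_induction_on generalizing v with
  | _ k ih =>
    rcases Nat.eq_zero_or_pos k with rfl | hpos
    · rw [h.eq_root v hk]; exact .refl
    · obtain ⟨w, hvw, hw⟩ := h.exists_parent v (by omega)
      refine .head (b := w) ⟨hvw, Set.mem_insert _ _, Or.inr (by simp; omega)⟩ ?_
      rw [h.root_eq v w hvw]
      refine (ih (lam w) (by omega) w rfl).mono (fun _ _ _ _ h => h) ?_
      rintro x (rfl | hx)
      · exact Or.inr (by simp; omega)
      · have hx : lam x < lam w := hx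
        exact Or.inr (by simp; omega)

theorem root_eq_of_reachIn (h : IsLayering G lam root) {T : Set V} {u v : V}
    (huv : ReachIn G T u v) : root u = root v := by
  induction huv with
  | refl => rfl
  | tail _ hxy ih => exact ih.trans (h.root_eq _ _ hxy.1)

/-- Layer 0 meets each component only in its root, so it contains no edge. -/
theorem pos_of_adj (h : IsLayering G lam root) {u v : V} (huv : G.Adj u v)
    (hl : lam u = lam v) : 0 < lam u := by
  by_contra h0
  refine huv.ne ?_
  rw [← h.eq_root u (by omega), ← h.eq_root v (by omega), h.root_eq u v huv]

/-- The neighbours of a connected part of the lower layers form a clique. -/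
theorem eq_or_adj (h : IsLayering G lam root) (hG : IsChordal G) {z z' x y : V}
    (hzy : lam z = lam y) (hzz' : G.Adj z z') (hxy : G.Adj x y)
    (hz' : lam z < lam z') (hreach : ReachIn G {w | lam z < lam w} z' x) :
    z = y ∨ G.Adj z y := by
  by_contra! hne
  -- Layers on the two sides of that of `z` are anticomplete. The connection through `A` is the
  -- given walk; the one through `B` passes through the common root.
  refine hne.2 (hG.adj_of_reachIn (A := {w | lam z < lam w}) (B := {w | lam w < lam z}) hne.1
    ?_ ?_ ?_)
  · intro a ha b hb
    have ha : lam z < lam a := ha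
    have hb : lam b < lam z := hb
    refine ⟨by rintro rfl; omega, fun hab => ?_⟩
    have := h.adj_le a b hab
    omega
  · have hx : lam z < lam x := hreach.mem_right hz'
    refine .head (b := z') ⟨hzz', Or.inl rfl, Or.inr (Or.inr hz')⟩ (.tail (b := x) ?_
      ⟨hxy, Or.inr (Or.inr hx), Or.inr (Or.inl rfl)⟩)
    exact hreach.mono (fun _ _ _ _ h => h) (fun w hw => Or.inr (Or.inr hw))
  · have hroot : root z = root y := (h.root_eq _ _ hzz').trans
      ((h.root_eq_of_reachIn hreach).trans (h.root_eq _ _ hxy))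
    refine ((h.reach_root z).mono (fun _ _ _ _ h => h) ?_).trans (hroot ▸
      ((h.reach_root y).mono (fun _ _ _ _ h => h) ?_).symm)
    · rintro w (rfl | hw)
      · exact Or.inl rfl
      · exact Or.inr (Or.inr hw)
    · rintro w (rfl | hw)
      · exact Or.inr (Or.inl rfl)
      · exact Or.inr (Or.inr (hzy ▸ hw))

end IsLayering

/-! ### Vertex rankings and treedepth. -/

/-- `φ` is a vertex ranking of `G[S]`: a connected set of vertices has at most one vertex of
minimum rank. -/
def Ranked {V : Type u} (G : SimpleGraph V) (S : Set V) (φ : V → ℕ) : Prop :=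
  ∀ u ∈ S, ∀ v, φ u = φ v → ReachIn G {w | w ∈ S ∧ φ u ≤ φ w} u v → u = v

/-- Call `u` an ancestor of `v` when `v` is reachable from `u` through ranks at least `φ u`. The
ancestors of `v` form a chain on which `φ` is injective; the parent is the proper ancestor of
greatest rank. The depth is the number of proper ancestors, at most `φ v` because their ranks are
distinct and below `φ v`. -/
theorem Ranked.hasTreedepthAtMost {V : Type u} [Finite V] {G : SimpleGraph V} {φ : V → ℕ} {d : ℕ}
    (h : Ranked G Set.univ φ) (hd : ∀ v, φ v < d) : HasTreedepthAtMost G d := by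
  classical
  let A : V → V → Prop := fun u v => ReachIn G {w | φ u ≤ φ w} u v
  have A_le : ∀ {u v}, A u v → φ u ≤ φ v := fun {u v} huv =>
    ReachIn.mem_right (T := {w | φ u ≤ φ w}) huv (le_refl (φ u))
  have A_eq : ∀ {u v}, A u v → φ u = φ v → u = v := fun {u v} huv he =>
    h u trivial v he (huv.mono (fun _ _ _ _ h => h) (fun w hw => ⟨trivial, hw⟩))
  have A_lt : ∀ {u v}, A u v → u ≠ v → φ u < φ v := fun huv hne =>
    lt_of_le_of_ne (A_le huv) (fun he => hne (A_eq huv he))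
  have A_trans : ∀ {u v w}, A u v → A v w → A u w := fun {u v w} huv hvw =>
    Relation.ReflTransGen.trans huv (hvw.mono (fun _ _ _ _ h => h)
      (fun _ hx => le_trans (A_le huv) hx))
  have A_lin : ∀ {u v w}, A u w → A v w → φ u ≤ φ v → A u v := fun {u v w} huw hvw hle =>
    Relation.ReflTransGen.trans huw (hvw.symm.mono (fun _ _ _ _ h => h)
      (fun _ hx => le_trans hle hx))
  have hpar : ∀ v, ∃ o : Option V, (o = none → ∀ u, A u v → u = v) ∧
      ∀ p, o = some p → A p v ∧ p ≠ v ∧ ∀ u, A u v → u ≠ v → A u p := by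
    intro v
    by_cases hne : ({u | A u v ∧ u ≠ v} : Set V).Nonempty
    · obtain ⟨p, hp, hmax⟩ := Set.exists_max_image _ φ (Set.toFinite _) hne
      refine ⟨some p, by simp, ?_⟩
      rintro _ ⟨⟩
      exact ⟨hp.1, hp.2, fun u hu hne => A_lin hu hp.1 (hmax u ⟨hu, hne⟩)⟩
    · refine ⟨none, fun _ u hu => ?_, by simp⟩
      by_contra huv
      exact hne ⟨u, hu, huv⟩
  choose par hnone hsome using hpar
  have hchild : ∀ v p, par v = some p →
      ({u | A u v ∧ u ≠ v} : Set V) = insert p {u | A u p ∧ u ≠ p} := by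
    intro v p hp
    obtain ⟨hpv, hne, hall⟩ := hsome v p hp
    ext u
    simp only [Set.mem_ofPred_eq, Set.mem_insert_iff]
    constructor
    · rintro ⟨hu, huv⟩
      by_cases e : u = p
      · exact Or.inl e
      · exact Or.inr ⟨hall u hu huv, e⟩
    · rintro (rfl | ⟨hup, hne'⟩)
      · exact ⟨hpv, hne⟩
      · refine ⟨A_trans hup hpv, ?_⟩
        rintro rfl
        exact lt_asymm (A_lt hup hne') (A_lt hpv hne)
  let F : RootedForest V :=
    { parent := par
      depth := fun v => ({u | A u v ∧ u ≠ v} : Set V).ncard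
      depth_root := fun v hv => by
        rw [Set.ncard_eq_zero, Set.eq_empty_iff_forall_notMem]
        exact fun u hu => hu.2 (hnone v hv u hu.1)
      depth_child := fun v p hp => by
        rw [hchild v p hp, Set.ncard_insert_of_notMem (by simp)] }
  have hF : ∀ u v, A u v → F.IsAncestor u v := by
    intro u v
    induction hk : φ v using Nat.strong_induction_on generalizing v with
    | _ k ih =>
      intro huv
      by_cases hne : u = v
      · subst hne; exact .refl
      · cases hp : par v with
        | none => exact (hne (hnone v hp u huv)).elim
        | some p =>
          obtain ⟨hpv, hpne, hall⟩ := hsome v p hp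
          exact .head hp (ih (φ p) (hk ▸ A_lt hpv hpne) p rfl (hall u huv hne))
  refine ⟨F, fun v => lt_of_le_of_lt ?_ (hd v), fun u v huv => ?_⟩
  · have hinj : Set.InjOn φ {u | A u v ∧ u ≠ v} := by
      intro x hx y hy hxy
      exact A_eq (A_lin hx.1 hy.1 hxy.le) hxy
    change ({u | A u v ∧ u ≠ v} : Set V).ncard ≤ φ v
    rw [← hinj.ncard_image]
    calc (φ '' {u | A u v ∧ u ≠ v}).ncard ≤ (Set.Iio (φ v)).ncard := by
          refine Set.ncard_le_ncard ?_ (Set.finite_Iio _)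
          rintro _ ⟨u, hu, rfl⟩
          exact A_lt hu.1 hu.2
      _ = φ v := by
          rw [← Finset.coe_Iio, Set.ncard_coe_finset, Nat.card_Iio]
  · rcases le_total (φ u) (φ v) with hle | hle
    · exact Or.inl (hF u v (.single ⟨huv, le_refl (φ u), hle⟩))
    · exact Or.inr (hF v u (.single ⟨huv.symm, le_refl (φ v), hle⟩))

theorem Ranked.induce {V : Type u} {G : SimpleGraph V} {S : Set V} {φ : V → ℕ}
    (h : Ranked G S φ) : Ranked (G.induce S) Set.univ (fun v => φ v) := by
  intro u _ v huv hreach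
  refine Subtype.ext (h u u.2 v huv ?_)
  exact Relation.ReflTransGen.lift Subtype.val
    (fun a b hab => ⟨hab.1, ⟨a.2, hab.2.1.2⟩, ⟨b.2, hab.2.2.2⟩⟩) _ _ hreach

theorem Ranked.td_induce_le {V : Type u} [Finite V] {G : SimpleGraph V} {S : Set V} {φ : V → ℕ}
    {d : ℕ} (h : Ranked G S φ) (hd : ∀ v ∈ S, φ v < d) : td.val (G.induce S) ≤ d := by
  have : treedepth (G.induce S) ≤ d :=
    Nat.sInf_le (h.induce.hasTreedepthAtMost fun v => hd v v.2)
  exact (Nat.cast_le (α := ℝ≥0)).2 this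

/-! ### From rankings of the layers to a ranking of the graph. -/

/-- A walk inside `T` along which `P` is preserved stays inside `T ∩ P`. -/
theorem ReachIn.inter {V : Type u} {G : SimpleGraph V} {T P : Set V} {u v : V}
    (h : ReachIn G T u v) (hu : u ∈ P)
    (hP : ∀ x y, G.Adj x y → x ∈ T → y ∈ T → x ∈ P → y ∈ P) : ReachIn G (T ∩ P) u v := by
  have : ReachIn G (T ∩ P) u v ∧ v ∈ P := by
    induction h with
    | refl => exact ⟨.refl, hu⟩
    | @tail x y _ hxy ih =>
      have hy := hP x y hxy.1 hxy.2.1 hxy.2.2 ih.2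
      exact ⟨.tail ih.1 ⟨hxy.1, ⟨hxy.2.1, ih.2⟩, hxy.2.2, hy⟩, hy⟩
  exact this.1

/-- The edges of `G` inside the layers of `lam`. -/
def sameLayer {V : Type u} (G : SimpleGraph V) (lam : V → ℕ) : SimpleGraph V where
  Adj x y := G.Adj x y ∧ lam x = lam y
  symm := ⟨fun _ _ h => ⟨h.1.symm, h.2.symm⟩⟩
  loopless := ⟨fun _ h => h.1.ne rfl⟩

/-- Every excursion of the walk into farther layers leaves and re-enters the layer of `u` at
vertices that are equal or adjacent, so it can be shortcut. -/
theorem IsLayering.reachIn_sameLayer {V : Type u} {G : SimpleGraph V} {lam : V → ℕ} {root : V → V}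
    (h : IsLayering G lam root) (hG : IsChordal G) {T : Set V} {u v : V}
    (hT : ∀ w ∈ T, lam u ≤ lam w) (huv : lam u = lam v) (hr : ReachIn G T u v) :
    ReachIn (sameLayer G lam) T u v := by
  -- During an excursion, the induction remembers the vertex `z` at which it left the layer and its
  -- first vertex `z'`.
  have key : ∀ x, ReachIn G T u x →
      (lam u = lam x → ReachIn (sameLayer G lam) T u x) ∧
      (lam u < lam x → ∃ z z', z ∈ T ∧ lam u = lam z ∧ ReachIn (sameLayer G lam) T u z ∧
        G.Adj z z' ∧ lam u < lam z' ∧ ReachIn G {w | lam u < lam w} z' x) := by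
    intro x hx
    induction hx with
    | refl => exact ⟨fun _ => .refl, fun h => (lt_irrefl _ h).elim⟩
    | @tail x y _ hxy ih =>
      obtain ⟨hadj, hxT, hyT⟩ := hxy
      rcases (hT x hxT).eq_or_lt with hx | hx
      · have hux := ih.1 hx
        refine ⟨fun hy => .tail hux ⟨⟨hadj, hx.symm.trans hy⟩, hxT, hyT⟩, fun hy => ?_⟩
        exact ⟨x, y, hxT, hx, hux, hadj, hy, .refl⟩
      · obtain ⟨z, z', hzT, hz, huz, hzz', hz', hr⟩ := ih.2 hx
        refine ⟨fun hy => ?_, fun hy => ⟨z, z', hzT, hz, huz, hzz', hz', .tail hr ⟨hadj, hx, hy⟩⟩⟩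
        rcases h.eq_or_adj hG (hz.symm.trans hy) hzz' hadj (hz ▸ hz') (hz ▸ hr) with rfl | hzy
        · exact huz
        · exact .tail huz ⟨⟨hzy, hz.symm.trans hy⟩, hzT, hyT⟩
  exact (key v hr).1 huv

theorem div_eq_div_of_le_add_one {m a b : ℕ} (ha : a % m ≠ 0) (hb : b % m ≠ 0)
    (hab : a ≤ b + 1) (hba : b ≤ a + 1) : a / m = b / m := by
  have key : ∀ a : ℕ, (a + 1) % m ≠ 0 → (a + 1) / m = a / m := by
    intro a h
    rw [Nat.succ_div, if_neg (fun hd => h (Nat.mod_eq_zero_of_dvd hd)), add_zero]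
  obtain rfl | rfl | rfl : a = b ∨ a = b + 1 ∨ b = a + 1 := by omega
  · rfl
  · exact key _ ha
  · exact (key _ hb).symm

theorem lex_of_mul_add_le {t r r' a b : ℕ} (hb : b < t)
    (h : r * t + a ≤ r' * t + b) : r < r' ∨ (r = r' ∧ a ≤ b) := by
  rcases lt_trichotomy r r' with hr | rfl | hr
  · exact Or.inl hr
  · exact Or.inr ⟨rfl, by omega⟩
  · have : (r' + 1) * t ≤ r * t := Nat.mul_le_mul_right t hr
    rw [add_mul, one_mul] at this
    omega

/-- Rankings of the layers of a chordal graph give a ranking of the graph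
with every `m`-th layer removed. -/
theorem IsLayering.ranked {V : Type u} {G : SimpleGraph V} {lam : V → ℕ} {root : V → V}
    (h : IsLayering G lam root) (hG : IsChordal G) {S : Set V} {ψ : V → ℕ} {m s t : ℕ}
    (hS : ∀ v ∈ S, (lam v + s) % m ≠ 0) (hψ : ∀ v, ψ v < t)
    (hR : Ranked (sameLayer G lam) S ψ) : Ranked G S (fun v => (lam v + s) % m * t + ψ v) := by
  intro u hu v huv hreach
  simp only at huv hreach
  have hr : (lam u + s) % m = (lam v + s) % m ∧ ψ u = ψ v := by
    rcases lex_of_mul_add_le (hψ v) huv.le with h1 | ⟨h1, h2⟩ <;>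
    rcases lex_of_mul_add_le (hψ u) huv.ge with h3 | ⟨h3, h4⟩ <;> omega
  -- The deleted layers, those of residue 0, separate the bands on which the quotient by `m` is
  -- constant.
  have hreach' := hreach.inter (P := {w | (lam u + s) / m = (lam w + s) / m}) rfl (by
    intro x y hxy hx hy hxP
    have hxP : (lam u + s) / m = (lam x + s) / m := hxP
    have h1 := h.adj_le x y hxy
    have h2 := h.adj_le y x hxy.symm
    exact hxP.trans (div_eq_div_of_le_add_one (hS x hx.1) (hS y hy.1) (by omega) (by omega)))
  have hv := hreach'.mem_right ⟨⟨hu, le_rfl⟩, rfl⟩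
  have hlam : ∀ x y, (lam x + s) / m = (lam y + s) / m → (lam x + s) % m ≤ (lam y + s) % m →
      lam x ≤ lam y := by
    intro x y h1 h2
    have h3 := Nat.div_add_mod (lam x + s) m
    have h4 := Nat.div_add_mod (lam y + s) m
    rw [h1] at h3
    omega
  have hluv : lam u = lam v :=
    le_antisymm (hlam u v hv.2 hr.1.le) (hlam v u hv.2.symm hr.1.ge)
  -- Within a band, rank at least that of `u` forces layer at least that of `u`.
  have hres := h.reachIn_sameLayer hG (fun w hw => hlam u w hw.2 (by
    rcases lex_of_mul_add_le (hψ w) hw.1.2 with h1 | ⟨h1, -⟩ <;> omega)) hluv hreach'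
  have hfin := hres.inter (P := {w | lam u = lam w}) rfl
    (fun x y hxy _ _ hx => Eq.trans hx hxy.2)
  refine hR u hu v hr.2 (hfin.mono (fun _ _ _ _ h => h) ?_)
  rintro w ⟨⟨⟨hwS, hle⟩, -⟩, hw⟩
  have hw : lam u = lam w := hw
  rw [hw] at hle
  exact ⟨hwS, by omega⟩

/-! ### Ranking paths by 2-adic valuation. -/

/-- Between two odd multiples of `2 ^ e` lies an even multiple. -/
theorem exists_padicValNat_two_lt {p q : ℕ} (hp : 0 < p) (hpq : p < q)
    (h : padicValNat 2 p = padicValNat 2 q) :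
    ∃ r, p < r ∧ r < q ∧ padicValNat 2 p < padicValNat 2 r := by
  have hdec : ∀ n, 0 < n → ∃ c, n = 2 ^ padicValNat 2 n * (2 * c + 1) := by
    intro n hn
    obtain ⟨k, hk⟩ := pow_padicValNat_dvd (p := 2) (n := n)
    rcases Nat.even_or_odd' k with ⟨c, rfl | rfl⟩
    · refine absurd ?_ (pow_succ_padicValNat_not_dvd (p := 2) hn.ne')
      exact ⟨c, by rw [pow_succ, mul_assoc]; exact hk⟩
    · exact ⟨c, hk⟩
  obtain ⟨c, hc⟩ := hdec p hp
  obtain ⟨d, hd⟩ := hdec q (hp.trans hpq)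
  rw [← h] at hd
  set e := padicValNat 2 p
  have h2 : 0 < 2 ^ e := by positivity
  have hcd : c < d := by
    rw [hc, hd] at hpq
    have := Nat.lt_of_mul_lt_mul_left hpq
    omega
  refine ⟨2 ^ e * (2 * c + 2), ?_, ?_, ?_⟩
  · rw [hc]; exact Nat.mul_lt_mul_of_pos_left (by omega) h2
  · rw [hd]; exact Nat.mul_lt_mul_of_pos_left (by omega) h2
  · refine (padicValNat_dvd_iff_le (p := 2) (by positivity)).1 ?_
    exact ⟨c + 1, by rw [Nat.succ_eq_add_one, pow_succ]; ring⟩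

/-- A ranking of a linear forest with every `m`-th vertex removed. -/
theorem ranked_of_position {V : Type u} {K : SimpleGraph V} {pos : V → ℕ}
    (hadj : ∀ u v, K.Adj u v → pos u ≤ pos v + 1)
    (hinj : ∀ u v, K.Reachable u v → pos u = pos v → u = v) {S : Set V} {m s t : ℕ} (hm : 0 < m)
    (hmt : m ≤ 2 ^ t) (hS : ∀ v ∈ S, (pos v + s) % m ≠ 0) :
    Ranked K S (fun v => t - 1 - padicValNat 2 ((pos v + s) % m)) := by
  -- Nonzero residues are below `2 ^ t`; thus the subtraction in the rank is never truncated on `S`.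
  have hval : ∀ v ∈ S, padicValNat 2 ((pos v + s) % m) < t := by
    intro v hv
    have h1 : 2 ^ padicValNat 2 ((pos v + s) % m) ≤ (pos v + s) % m :=
      Nat.le_of_dvd (Nat.pos_of_ne_zero (hS v hv)) pow_padicValNat_dvd
    exact (Nat.pow_lt_pow_iff_right one_lt_two).1
      (h1.trans_lt ((Nat.mod_lt _ hm).trans_le hmt))
  have hblock : ∀ x y, K.Adj x y → x ∈ S → y ∈ S → (pos x + s) / m = (pos y + s) / m := by
    intro x y hxy hx hy
    have h1 := hadj x y hxy
    have h2 := hadj y x hxy.symm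
    exact div_eq_div_of_le_add_one (hS x hx) (hS y hy) (by omega) (by omega)
  have key : ∀ u ∈ S, ∀ v ∈ S, padicValNat 2 ((pos u + s) % m) = padicValNat 2 ((pos v + s) % m) →
      ReachIn K {w | w ∈ S ∧ padicValNat 2 ((pos w + s) % m) ≤ padicValNat 2 ((pos u + s) % m)}
        u v → ¬ (pos u + s) % m < (pos v + s) % m := by
    intro u hu v hv huv hr hlt
    -- Residues change by at most one along the walk, which would have to visit residue `r`; its
    -- larger valuation is not allowed there.
    obtain ⟨r, h1, h2, h3⟩ := exists_padicValNat_two_lt (Nat.pos_of_ne_zero (hS u hu)) hlt huv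
    have := (hr.inter (P := {w | (pos w + s) % m < r}) h1 (by
      intro x y hxy hx hy hxr
      have hxr : (pos x + s) % m < r := hxr
      have hb := hblock x y hxy hx.1 hy.1
      have hd1 := Nat.div_add_mod (pos x + s) m
      have hd2 := Nat.div_add_mod (pos y + s) m
      have ha := hadj y x hxy.symm
      have hne : (pos y + s) % m ≠ r := by
        rintro rfl
        exact absurd hy.2 (by omega)
      rw [hb] at hd1
      change (pos y + s) % m < r
      omega)).mem_right ⟨⟨hu, le_rfl⟩, h1⟩
    have : (pos v + s) % m < r := this.2
    omega
  intro u hu v huv hreach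
  have hv := (hreach.mem_right ⟨hu, le_rfl⟩).1
  have hu' := hval u hu
  have hv' := hval v hv
  have he : padicValNat 2 ((pos u + s) % m) = padicValNat 2 ((pos v + s) % m) := by
    simp only at huv; omega
  have hr : ReachIn K
      {w | w ∈ S ∧ padicValNat 2 ((pos w + s) % m) ≤ padicValNat 2 ((pos u + s) % m)} u v := by
    refine hreach.mono (fun _ _ _ _ h => h) ?_
    rintro w ⟨hw, hle⟩
    have := hval w hw
    simp only at hle
    exact ⟨hw, by omega⟩
  have hmod : (pos u + s) % m = (pos v + s) % m := by
    have h1 := key u hu v hv he hr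
    have h2 := key v hv u hu he.symm (he ▸ hr.symm)
    omega
  have hdiv : (pos u + s) / m = (pos v + s) / m := by
    have := (hr.inter (P := {w | (pos u + s) / m = (pos w + s) / m}) rfl
      (fun x y hxy hx hy hxP => Eq.trans hxP (hblock x y hxy hx.1 hy.1))).mem_right
      ⟨⟨hu, le_rfl⟩, rfl⟩
    exact this.2
  refine hinj u v ((SimpleGraph.reachable_iff_reflTransGen _ _).2
    (Relation.ReflTransGen.mono (fun _ _ h => h.1) _ _ hr)) ?_
  have h1 := Nat.div_add_mod (pos u + s) m
  have h2 := Nat.div_add_mod (pos v + s) m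
  rw [hdiv, hmod] at h1
  omega

/-! ### Two nested layerings of a planar chordal graph leave a linear forest. -/

/-- A cycle is connected, so it lies in one layer, where the two adjacency relations agree. -/
theorem IsChordal.sameLayer {V : Type u} {G : SimpleGraph V} (hG : IsChordal G) (lam : V → ℕ) :
    IsChordal (sameLayer G lam) := by
  intro n hn
  refine ⟨fun f => (hG n hn).false ⟨f.toEmbedding, ?_⟩⟩
  intro i j
  have hconst : lam (f i) = lam (f j) := by
    have := (SimpleGraph.reachable_iff_reflTransGen _ _).1
      (SimpleGraph.cycleGraph_preconnected i j)
    clear hn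
    induction this with
    | refl => rfl
    | tail _ h ih => exact ih.trans (f.map_rel_iff.2 h).2
  exact ⟨fun h => f.map_rel_iff.1 ⟨h, hconst⟩, fun h => (f.map_rel_iff.2 h).1⟩

theorem IsLayering.lam_root {V : Type u} {G : SimpleGraph V} {lam : V → ℕ} {root : V → V}
    (h : IsLayering G lam root) (v : V) : lam (root v) = 0 := by
  induction hk : lam v using Nat.strong_induction_on generalizing v with
  | _ k ih =>
    by_cases h0 : lam v = 0
    · rw [h.eq_root v h0, h0]
    · obtain ⟨w, hvw, hw⟩ := h.exists_parent v h0
      rw [h.root_eq v w hvw]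
      exact ih (lam w) (by omega) w rfl

section Layers

variable {V : Type u} {G : SimpleGraph V} {lam mu : V → ℕ} {root rho : V → V}

/-- The roots of two nested layerings are hubs seeing all vertices of a doubly indexed layer. -/
theorem IsLayering.exists_hubs (h : IsLayering G lam root)
    (h' : IsLayering (sameLayer G lam) mu rho) {x y : V}
    (hxy : (sameLayer (sameLayer G lam) mu).Adj x y) :
    ∃ (A B : Set V) (a b : V), a ∈ A ∧ b ∈ B ∧ Disjoint A B ∧
      ReachIn G ({b} ∪ A) b a ∧
      ∀ v, (v = x ∨ (sameLayer (sameLayer G lam) mu).Adj x v) →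
        v ∉ A ∧ v ∉ B ∧ ReachIn G ({v} ∪ A) v a ∧ ReachIn G ({v} ∪ B) v b := by
  have hlam : 0 < lam x := h.pos_of_adj hxy.1.1 hxy.1.2
  have hmu : 0 < mu x := h'.pos_of_adj hxy.1 hxy.2
  have hB : ∀ v, lam v = lam x → mu v = mu x → rho v = rho x →
      ReachIn G ({v} ∪ {w | lam w = lam x ∧ mu w < mu x}) v (rho x) := by
    intro v h1 h2 h3
    have := (h'.reach_root v).inter (P := {w | lam w = lam x}) h1
      (fun p q hpq _ _ hp => Eq.trans hpq.2.symm hp)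
    rw [h3] at this
    refine this.mono (fun _ _ _ _ h => h.1) ?_
    rintro w ⟨rfl | hw, hw'⟩
    · exact Or.inl rfl
    · exact Or.inr ⟨hw', h2 ▸ hw⟩
  have hA : ∀ v, lam v = lam x → root v = root x →
      ReachIn G ({v} ∪ {w | lam w < lam x}) v (root x) := by
    intro v h1 h2
    have := h.reach_root v
    rw [h1, h2] at this
    exact this
  -- Here `mu x > 0` is essential: it prevents `x` from being its own hub.
  have hb : rho x ∈ {w | lam w = lam x ∧ mu w < mu x} := by
    rcases (hB x rfl rfl rfl).mem_right (Or.inl rfl) with hx | hx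
    · have h0 := h'.lam_root x
      rw [Set.mem_singleton_iff.1 hx] at h0
      omega
    · exact hx
  refine ⟨{w | lam w < lam x}, {w | lam w = lam x ∧ mu w < mu x}, root x, rho x, ?_, hb, ?_, ?_, ?_⟩
  · change lam (root x) < lam x
    rw [h.lam_root]; exact hlam
  · rw [Set.disjoint_left]
    intro w hw hw'
    exact absurd hw'.1 (ne_of_lt hw)
  · exact hA _ hb.1 (h.root_eq_of_reachIn (hB x rfl rfl rfl)).symm
  · intro v hv
    have hv : lam v = lam x ∧ mu v = mu x ∧ root v = root x ∧ rho v = rho x := by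
      rcases hv with rfl | hv
      · exact ⟨rfl, rfl, rfl, rfl⟩
      · exact ⟨hv.1.2.symm, hv.2.symm, (h.root_eq _ _ hv.1.1).symm, (h'.root_eq _ _ hv.1).symm⟩
    obtain ⟨h1, h2, h3, h4⟩ := hv
    refine ⟨fun hv => ?_, fun hv => ?_, hA v h1 h3, hB v h1 h2 h4⟩
    · exact absurd h1 (ne_of_lt hv)
    · exact absurd h2 (ne_of_lt hv.2)

theorem reachIn_pair {V : Type u} {G : SimpleGraph V} {u v : V} (h : G.Adj u v) :
    ReachIn G ({u} ∪ {v}) u v :=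
  .single ⟨h, Or.inl rfl, Or.inr rfl⟩

/-- The triangle and the two hubs model `K₅`; the hubs are joined because `b` reaches the root `a`
through `A`. -/
theorem IsPlanar.triangle_free_layers (hG : IsPlanar G) (h : IsLayering G lam root)
    (h' : IsLayering (sameLayer G lam) mu rho) {x y z : V}
    (hxy : (sameLayer (sameLayer G lam) mu).Adj x y)
    (hxz : (sameLayer (sameLayer G lam) mu).Adj x z)
    (hyz : (sameLayer (sameLayer G lam) mu).Adj y z) : False := by
  obtain ⟨A, B, a, b, ha, hb, hAB, hba, hv⟩ := h.exists_hubs h' hxy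
  obtain ⟨hx1, hx2, hx3, hx4⟩ := hv x (Or.inl rfl)
  obtain ⟨hy1, hy2, hy3, hy4⟩ := hv y (Or.inr hxy)
  obtain ⟨hz1, hz2, hz3, hz4⟩ := hv z (Or.inr hxz)
  have hba' : ReachIn G (B ∪ A) b a := hba.mono (fun _ _ _ _ h => h)
    (Set.union_subset_union_left _ (Set.singleton_subset_iff.2 hb))
  refine hG.not_model_completeGraph_five (B := ![{x}, {y}, {z}, B, A]) (b := ![x, y, z, b, a])
    ⟨?_, ?_, ?_⟩
  · simp [Fin.forall_fin_succ, ha, hb]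
  · have := hxy.ne; have := hxy.ne'; have := hxz.ne; have := hxz.ne'; have := hyz.ne
    have := hyz.ne'
    simp [Fin.forall_fin_succ, *, hAB.symm]
  · simp [Fin.forall_fin_succ, hx3, hx4, hy3, hy4, hz3, hz4, hba', reachIn_pair hxy.1.1,
      reachIn_pair hxz.1.1, reachIn_pair hyz.1.1, -Set.singleton_union,
      -Set.union_singleton]

/-- The centre `c` and the two hubs form one side of a `K₃,₃`, and `x`, `y`, `z` the other. -/
theorem IsPlanar.claw_free_layers (hG : IsPlanar G) (h : IsLayering G lam root)
    (h' : IsLayering (sameLayer G lam) mu rho) {c x y z : V}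
    (hx : (sameLayer (sameLayer G lam) mu).Adj c x)
    (hy : (sameLayer (sameLayer G lam) mu).Adj c y)
    (hz : (sameLayer (sameLayer G lam) mu).Adj c z) : x = y ∨ x = z ∨ y = z := by
  by_contra! hne
  obtain ⟨hxy, hxz, hyz⟩ := hne
  obtain ⟨A, B, a, b, ha, hb, hAB, -, hv⟩ := h.exists_hubs h' hx
  obtain ⟨hc1, hc2, -, -⟩ := hv c (Or.inl rfl)
  obtain ⟨hx1, hx2, hx3, hx4⟩ := hv x (Or.inr hx)
  obtain ⟨hy1, hy2, hy3, hy4⟩ := hv y (Or.inr hy)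
  obtain ⟨hz1, hz2, hz3, hz4⟩ := hv z (Or.inr hz)
  have hcomm : ∀ {S T : Set V} {u v : V}, ReachIn G (S ∪ T) u v → ReachIn G (T ∪ S) v u :=
    fun {S T u v} hr => Set.union_comm S T ▸ hr.symm
  refine hG.not_model_completeBipartite_three_three (B := ![{c}, A, B, {x}, {y}, {z}])
    (b := ![c, a, b, x, y, z]) ⟨?_, ?_, ?_⟩
  · simp [Fin.forall_fin_succ, ha, hb]
  · have := hx.ne; have := hx.ne'; have := hy.ne; have := hy.ne'; have := hz.ne
    have := hz.ne'
    simp [Fin.forall_fin_succ, *, hAB.symm, hxy.symm, hxz.symm, hyz.symm]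
  · simp [Fin.forall_fin_succ, hcomm hx3, hcomm hx4, hcomm hy3, hcomm hy4, hcomm hz3, hcomm hz4,
      reachIn_pair hx.1.1, reachIn_pair hy.1.1, reachIn_pair hz.1.1, -Set.singleton_union,
      -Set.union_singleton]

end Layers

/-- In a triangle-free chordal graph, every component has a vertex of degree at most one. -/
theorem IsChordal.exists_leaf {V : Type u} [Finite V] {K : SimpleGraph V} (hK : IsChordal K)
    (htri : ∀ x y z, K.Adj x y → K.Adj x z → K.Adj y z → False) (r : V) :
    ∃ v, K.Reachable r v ∧ ∀ x y, K.Adj v x → K.Adj v y → x = y := by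
  obtain ⟨lam, root, h⟩ := exists_isLayering K
  obtain ⟨v, hv, hmax⟩ := Set.exists_max_image {v | K.Reachable r v} lam (Set.toFinite _)
    ⟨r, SimpleGraph.Reachable.refl r⟩
  refine ⟨v, hv, ?_⟩
  have hlow : ∀ x, K.Adj v x → lam x + 1 = lam v := by
    intro x hvx
    have h1 := hmax x (SimpleGraph.Reachable.trans hv hvx.reachable)
    have h2 := h.adj_le v x hvx
    -- For a neighbour `x` in the layer of the farthest vertex `v`, the parents `p` of `v` and `q`
    -- of `x` are equal or adjacent. This gives a triangle, or a 4-cycle whose chord creates one.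
    by_contra hne
    have heq : lam v = lam x := by omega
    have hpos := h.pos_of_adj hvx heq
    obtain ⟨p, hvp, hp⟩ := h.exists_parent v (by omega)
    obtain ⟨q, hxq, hq⟩ := h.exists_parent x (by omega)
    rcases h.eq_or_adj hK (z := p) (y := q) (z' := v) (x := x) (by omega) hvp.symm hxq (by omega)
      (.single ⟨hvx, by simp; omega, by simp; omega⟩) with rfl | hpq
    · exact htri v x p hvx hvp hxq
    · have hne : p ≠ x := by rintro rfl; omega
      refine htri v p x hvp hvx (hK.adj_of_reachIn (A := {v}) (B := {q}) hne ?_ ?_ ?_)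
      · rintro _ rfl _ rfl
        refine ⟨by rintro rfl; omega, fun hvq => htri _ _ _ hvp hvq hpq⟩
      · exact .head (b := v) ⟨hvp.symm, by simp, by simp⟩ (.single ⟨hvx, by simp, by simp⟩)
      · exact .head (b := q) ⟨hpq, by simp, by simp⟩ (.single ⟨hxq.symm, by simp, by simp⟩)
  intro x y hx hy
  have h1 := hlow x hx
  have h2 := hlow y hy
  rcases h.eq_or_adj hK (z := x) (y := y) (by omega) hx.symm hy (by omega) .refl with e | e
  · exact e
  · exact (htri v x y hx hy e).elim

/-- Positions of the vertices of a linear forest along its paths. -/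
theorem IsChordal.exists_position {V : Type u} [Finite V] {K : SimpleGraph V} (hK : IsChordal K)
    (htri : ∀ x y z, K.Adj x y → K.Adj x z → K.Adj y z → False)
    (hclaw : ∀ c x y z, K.Adj c x → K.Adj c y → K.Adj c z → x = y ∨ x = z ∨ y = z) :
    ∃ pos : V → ℕ, (∀ u v, K.Adj u v → pos u ≤ pos v + 1) ∧
      ∀ u v, K.Reachable u v → pos u = pos v → u = v := by
  choose leaf hleaf hdeg using hK.exists_leaf htri
  let root : V → V := fun v => leaf (K.connectedComponentMk v).out
  have hroot : ∀ v, K.Reachable (root v) v := fun v =>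
    (hleaf _).symm.trans (SimpleGraph.ConnectedComponent.exact (Quot.out_eq _))
  have hcomp : ∀ u v, K.Reachable u v → root u = root v := fun u v h => by
    simp only [root]
    rw [SimpleGraph.ConnectedComponent.sound h]
  obtain ⟨pos, h⟩ : ∃ pos, IsLayering K pos root :=
    ⟨_, isLayering_dist hroot fun u v huv => hcomp u v huv.reachable⟩
  refine ⟨pos, h.adj_le, ?_⟩
  intro u v
  induction hk : pos u using Nat.strong_induction_on generalizing u v with
  | _ k ih =>
    intro huv hpos
    by_cases h0 : k = 0
    · rw [← h.eq_root u (by omega), ← h.eq_root v (by omega),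
        hcomp u v huv]
    · obtain ⟨w, huw, hw⟩ := h.exists_parent u (by omega)
      obtain ⟨w', hvw, hw'⟩ := h.exists_parent v (by omega)
      obtain rfl := ih (pos w) (by omega) w w' rfl
        ((huw.reachable.symm.trans huv).trans hvw.reachable) (by omega)
      -- Distinct `u` and `v` with common parent `w` would give the root, a leaf, two neighbours, or
      -- else form a claw with the parent of `w`.
      by_cases hw0 : pos w = 0
      · have hw1 := h.eq_root w hw0
        exact hdeg _ u v (by rw [← hw1] at huw; exact huw.symm)
          (by change K.Adj (root w) v; rw [hw1]; exact hvw.symm)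
      · obtain ⟨x, hwx, hx⟩ := h.exists_parent w hw0
        rcases hclaw w u v x huw.symm hvw.symm hwx with e | e | e
        · exact e
        · subst e; omega
        · subst e; omega

/-! ### The random deletion set and its rate. -/

/-- Deletion sets indexed by an offset `k`, such that each vertex is in few of them. -/
theorem planarChordal.exists_deletion_family {V : Type u} [Finite V] {G : SimpleGraph V}
    (hG : IsPlanar G) (hc : IsChordal G) {a t : ℕ} (ha : 0 < a) (ht : 4 * a ≤ 2 ^ t) :
    ∃ (D : ℕ → Set V) (lam mu pos : V → ℕ),
      (∀ k v, v ∈ D k ↔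
        (lam v + k) % (2 * a) = 0 ∨ (mu v + k) % (4 * a) = 0 ∨ (pos v + k) % (4 * a) = 0) ∧
      ∀ k, td.val (G.induce (D k)ᶜ) ≤ ((2 * a * (4 * a * t) : ℕ) : ℝ≥0) := by
  obtain ⟨lam, root, h⟩ := exists_isLayering G
  obtain ⟨mu, rho, h'⟩ := exists_isLayering (sameLayer G lam)
  obtain ⟨pos, hadj, hinj⟩ := ((hc.sameLayer lam).sameLayer mu).exists_position
    (fun x y z => hG.triangle_free_layers h h') (fun c x y z => hG.claw_free_layers h h')
  refine ⟨fun k => {v | (lam v + k) % (2 * a) = 0 ∨ (mu v + k) % (4 * a) = 0 ∨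
    (pos v + k) % (4 * a) = 0}, lam, mu, pos, fun k v => Iff.rfl, fun k => ?_⟩
  set S : Set V := {v | (lam v + k) % (2 * a) = 0 ∨ (mu v + k) % (4 * a) = 0 ∨
    (pos v + k) % (4 * a) = 0}ᶜ with hSdef
  have hS : ∀ v ∈ S, (lam v + k) % (2 * a) ≠ 0 ∧ (mu v + k) % (4 * a) ≠ 0 ∧
      (pos v + k) % (4 * a) ≠ 0 := by
    intro v hv
    have hv : ¬ _ := hv
    simpa only [Set.mem_ofPred_eq, not_or] using hv
  have bound : ∀ {x m b t : ℕ}, 0 < m → b < t → x % m * t + b < m * t := by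
    intro x m b t hm hb
    calc x % m * t + b < x % m * t + t := by omega
      _ = (x % m + 1) * t := by ring
      _ ≤ m * t := Nat.mul_le_mul_right t (Nat.mod_lt _ hm)
  have ht0 : 0 < t := by
    rcases Nat.eq_zero_or_pos t with rfl | h
    · omega
    · exact h
  -- The numbers of ranks multiply from the inside out: `t`, then `4a · t`, then `2a · 4a · t`.
  have h1 := ranked_of_position hadj hinj (m := 4 * a) (s := k) (by omega) ht
    (fun v hv => (hS v hv).2.2)
  have h2 := h'.ranked (hc.sameLayer lam) (m := 4 * a) (s := k) (t := t)
    (fun v hv => (hS v hv).2.1) (fun v => by omega) h1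
  have h3 := h.ranked hc (m := 2 * a) (s := k) (t := 4 * a * t) (fun v hv => (hS v hv).1)
    (fun v => bound (by omega) (by omega)) h2
  exact h3.td_induce_le fun v _ => bound (by omega) (bound (by omega) (by omega))

theorem card_offsets_le_one (m y : ℕ) :
    (Finset.univ.filter fun k : Fin m => (y + k) % m = 0).card ≤ 1 := by
  rw [Finset.card_le_one]
  intro k hk l hl
  simp only [Finset.mem_filter, Finset.mem_univ, true_and] at hk hl
  have : (y + k) ≡ (y + l) [MOD m] := hk.trans hl.symm
  exact Fin.ext ((Nat.ModEq.add_left_cancel' y this).eq_of_lt_of_lt k.2 l.2)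

/-- The condition modulo `2a` splits into two residues modulo `4a`; each of the resulting four
conditions determines the offset. -/
theorem card_offsets_le_four (a x y z : ℕ) :
    (Finset.univ.filter fun k : Fin (4 * a) => (x + k) % (2 * a) = 0 ∨ (y + k) % (4 * a) = 0 ∨
      (z + k) % (4 * a) = 0).card ≤ 4 := by
  have hsub : (Finset.univ.filter fun k : Fin (4 * a) => (x + k) % (2 * a) = 0 ∨
      (y + k) % (4 * a) = 0 ∨ (z + k) % (4 * a) = 0) ⊆
      ((Finset.univ.filter fun k : Fin (4 * a) => (x + k) % (4 * a) = 0) ∪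
        (Finset.univ.filter fun k : Fin (4 * a) => (x + 2 * a + k) % (4 * a) = 0)) ∪
      ((Finset.univ.filter fun k : Fin (4 * a) => (y + k) % (4 * a) = 0) ∪
        (Finset.univ.filter fun k : Fin (4 * a) => (z + k) % (4 * a) = 0)) := by
    intro k hk
    simp only [Finset.mem_filter, Finset.mem_univ, true_and, Finset.mem_union] at hk ⊢
    rcases hk with hk | hk | hk
    · left
      obtain ⟨q, hq⟩ := Nat.dvd_of_mod_eq_zero hk
      rcases Nat.even_or_odd' q with ⟨c, rfl | rfl⟩
      · exact Or.inl (Nat.mod_eq_zero_of_dvd ⟨c, by rw [hq]; ring⟩)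
      · exact Or.inr (Nat.mod_eq_zero_of_dvd ⟨c + 1, by rw [add_right_comm, hq]; ring⟩)
    · exact Or.inr (Or.inl hk)
    · exact Or.inr (Or.inr hk)
  refine (Finset.card_le_card hsub).trans ((Finset.card_union_le _ _).trans ?_)
  have h1 := Finset.card_union_le
    (Finset.univ.filter fun k : Fin (4 * a) => (x + k) % (4 * a) = 0)
    (Finset.univ.filter fun k : Fin (4 * a) => (x + 2 * a + k) % (4 * a) = 0)
  have h2 := Finset.card_union_le
    (Finset.univ.filter fun k : Fin (4 * a) => (y + k) % (4 * a) = 0)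
    (Finset.univ.filter fun k : Fin (4 * a) => (z + k) % (4 * a) = 0)
  have := card_offsets_le_one (4 * a) x
  have := card_offsets_le_one (4 * a) (x + 2 * a)
  have := card_offsets_le_one (4 * a) y
  have := card_offsets_le_one (4 * a) z
  omega

theorem four_mul_le_two_pow {a : ℕ} (ha : 0 < a) :
    4 * a ≤ 2 ^ (2 + ⌈Real.logb 2 (a : ℝ)⌉₊) := by
  have h1 : (a : ℝ) ≤ 2 ^ ⌈Real.logb 2 (a : ℝ)⌉₊ := by
    rw [← Real.rpow_natCast, ← Real.logb_le_iff_le_rpow one_lt_two (by exact_mod_cast ha)]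
    exact Nat.le_ceil _
  have h2 : a ≤ 2 ^ ⌈Real.logb 2 (a : ℝ)⌉₊ := by exact_mod_cast h1
  rw [pow_add]
  omega

theorem monotone_rate :
    Monotone fun a : ℕ => 8 * (a : ℝ≥0) ^ 2 * (2 + (⌈Real.logb 2 (a : ℝ)⌉₊ : ℝ≥0)) := by
  intro a b hab
  rcases Nat.eq_zero_or_pos a with rfl | ha
  · simp
  have hlog : Real.logb 2 (a : ℝ) ≤ Real.logb 2 (b : ℝ) :=
    Real.logb_le_logb_of_le one_lt_two (by exact_mod_cast ha) (by exact_mod_cast hab)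
  have hceil : (⌈Real.logb 2 (a : ℝ)⌉₊ : ℝ≥0) ≤ (⌈Real.logb 2 (b : ℝ)⌉₊ : ℝ≥0) :=
    Nat.cast_le.2 (Nat.ceil_le_ceil hlog)
  have hab' : (a : ℝ≥0) ≤ b := Nat.cast_le.2 hab
  dsimp only
  gcongr

end Fragility

theorem mainTheorem9 :
    Fragility.GraphClass.IsFractionallyFragile Fragility.planarChordal.{u} Fragility.td.{u}
      (fun a : ℕ => 8 * (a : ℝ≥0) ^ 2 * (2 + (⌈Real.logb 2 (a : ℝ)⌉₊ : ℝ≥0))) := by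
  classical
  rintro V _ G ⟨hG, hc⟩
  refine ⟨Fragility.monotone_rate, fun a ha => ?_⟩
  obtain ⟨D, lam, mu, pos, hD, htd⟩ := Fragility.planarChordal.exists_deletion_family hG hc ha
    (Fragility.four_mul_le_two_pow ha)
  have : NeZero (4 * a) := ⟨by omega⟩
  -- A common period `4a` lets one offset serve all three deletions, so the thinness bound becomes
  -- the count `4 / (4a)`.
  refine ⟨(PMF.uniformOfFintype (Fin (4 * a))).map fun k : Fin (4 * a) => D k, ?_, fun v => ?_⟩
  · intro Y hY
    obtain ⟨k, -, rfl⟩ := (PMF.mem_support_map_iff _ _ _).1 hY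
    refine (NNReal.coe_le_coe.2 (htd k)).trans (le_of_eq ?_)
    push_cast
    ring
  · rw [PMF.toOuterMeasure_map_apply, PMF.toOuterMeasure_uniformOfFintype_apply]
    have hcard : Fintype.card ((fun k : Fin (4 * a) => D k) ⁻¹' {Y | v ∈ Y}) ≤ 4 := by
      refine le_trans (le_of_eq ?_)
        (Fragility.card_offsets_le_four a (lam v) (mu v) (pos v))
      rw [Fintype.card_subtype]
      congr 1
      ext k
      simp [hD]
    rw [Fintype.card_fin, ENNReal.ofReal_div_of_pos (by exact_mod_cast ha), ENNReal.ofReal_one,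
      ENNReal.ofReal_natCast]
    calc _ ≤ (4 : ℝ≥0∞) / ((4 * a : ℕ) : ℝ≥0∞) := by
          gcongr
          exact_mod_cast hcard
      _ = 1 / a := by
          rw [Nat.cast_mul, Nat.cast_ofNat]
          nth_rw 1 [← mul_one (4 : ℝ≥0∞)]
          exact ENNReal.mul_div_mul_left _ _ (by norm_num) (by norm_num)
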